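/- A datalog rule is an expression $P\bar x\leftarrow Q_1\bar y_1,\dots,Q_m\bar y_m$ ($m\ge 0$) whose head $P\bar x$ and body atoms $Q_r\bar y_r$ consist of a relation symbol of fixed arity ($0$ allowed) and a tuple of variables of that length; variables may be repeated, and head variables need not occur in the body. A datalog program $\Pi$ is a finite set of rules. The relation symbols occurring in heads of rules of $\Pi$ are its IDBs, all other relation symbols occurring in $\Pi$ are its EDBs. The program $\Pi$ is over a class $C$ of relational structures if, for every $\mathcal A\in C$, the vocabulary of $\mathcal A$ contains all EDBs and none of the IDBs of $\Pi$. The length $|\Pi|$ is the total number of occurrences of relation symbols and variables in the rules of $\Pi$. On a structure $\mathcal A$ all IDBs are initially interpreted by the empty relation, and the EDBs are interpreted as in $\mathcal A$. Applying a rule adds to the relation of its head symbol $P$ all tuples $\bar a$ for which there are tuples $\bar b_1,\dots,\bar b_m$ such that equal variables of the rule receive equal elements and each $\bar b_r$ lies in the current interpretation of $Q_r$; all other relations are unchanged. A computation sequence for $\Pi$ on $\mathcal A$ is either a finite sequence of rules of $\Pi$ after whose successive application no rule of $\Pi$ adds a tuple, or an infinite sequence of rules of $\Pi$ in which each rule of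 $\Pi$ occurs infinitely often. The closure ordinal $\operatorname{cl}(\Pi,\mathcal A)\in\mathbb N\cup\{\infty\}$ is the length of a shortest computation sequence for $\Pi$ on $\mathcal A$. The uniform closure ordinal $\operatorname{ucl}(\Pi,C)$ is the maximum of $\operatorname{cl}(\Pi,\mathcal A)$ over $\mathcal A\in C$ if it exists, and $\infty$ otherwise; $\Pi$ is uniformly bounded on $C$ if $\operatorname{ucl}(\Pi,C)<\infty$. Theorem. Let LO be the class of all strict linear orders $(A,<)$, finite or infinite, viewed as structures of vocabulary $\{<\}$. Every datalog program over LO is uniformly bounded on LO. More precisely, there is a computable function $b:\mathbb N\to\mathbb N$ such that $\operatorname{ucl}(\Pi,\mathrm{LO})\le b(|\Pi|)$ for every datalog program $\Pi$ over LO. -/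

import Mathlib

universe u

namespace Datalog

/-- A relation symbol together with its fixed arity (`0` is allowed). There are countably many
symbols of every arity. -/
structure RelSym where
  name : ℕ
  arity : ℕ
  deriving DecidableEq

/-- The binary relation symbol `<`. -/
def ltSym : RelSym := ⟨0, 2⟩

/-- An atom `P(x₁, …, x_k)`, where `k` is the arity of `P`; variables are natural numbers and may
be repeated. -/
structure Atom where
  rel : RelSym
  args : Fin rel.arity → ℕ

/-- A datalog rule `P x̄ ← Q₁ ȳ₁, …, Q_m ȳ_m` (with `m = 0` allowed). -/
structure Rule where
  head : Atom
  body : List Atom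

/-- A datalog program is a finite set of datalog rules. -/
abbrev Program := Finset Rule

/-- A relational structure over a finite vocabulary. -/
structure Struc where
  carrier : Type u
  vocab : Finset RelSym
  rel : (R : RelSym) → R ∈ vocab → Set (Fin R.arity → carrier)

/-- The number of symbols in an atom: the relation symbol and the occurrences of variables. -/
def Atom.size (α : Atom) : ℕ := 1 + α.rel.arity

/-- The number of symbols in a rule. -/
def Rule.size (ρ : Rule) : ℕ := ρ.head.size + (ρ.body.map Atom.size).sum

/-- The length `|Π|` of a program: the total number of occurrences of relation symbols and of
variables in its rules. -/
def Program.size (P : Program) : ℕ := ∑ ρ ∈ P, ρ.size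

/-- The relation symbol `R` occurs in the rule `ρ`. -/
def Rule.Occurs (ρ : Rule) (R : RelSym) : Prop :=
  ρ.head.rel = R ∨ ∃ α ∈ ρ.body, α.rel = R

/-- The intensional relation symbols: those that occur in the head of a rule. -/
def Program.IDB (P : Program) : Set RelSym := {R | ∃ ρ ∈ P, ρ.head.rel = R}

/-- The extensional relation symbols: all other symbols that occur in the program. -/
def Program.EDB (P : Program) : Set RelSym := {R | (∃ ρ ∈ P, ρ.Occurs R) ∧ R ∉ P.IDB}

/-- `P` is a program over the structure `𝒜`: the vocabulary of `𝒜` contains all EDBs and none of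
the IDBs. -/
def Program.IsOver (P : Program) (𝒜 : Struc.{u}) : Prop :=
  (∀ R ∈ P.EDB, R ∈ 𝒜.vocab) ∧ ∀ R ∈ P.IDB, R ∉ 𝒜.vocab

/-- `P` is a program over the class `C`. -/
def Program.IsOverClass (P : Program) (C : Set Struc.{u}) : Prop :=
  ∀ 𝒜 ∈ C, P.IsOver 𝒜

/-- A stage of a computation: a relation on `A` for every relation symbol (only the values at IDBs
are used). -/
abbrev Stage (A : Type u) := (R : RelSym) → Set (Fin R.arity → A)

/-- The tuple `t` is in the current interpretation of `Q`: IDBs are interpreted by the stage `S`,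
EDBs by the structure. -/
def Holds (P : Program) (𝒜 : Struc.{u}) (S : Stage 𝒜.carrier) (Q : RelSym)
    (t : Fin Q.arity → 𝒜.carrier) : Prop :=
  (Q ∈ P.IDB ∧ t ∈ S Q) ∨ (Q ∉ P.IDB ∧ ∃ h : Q ∈ 𝒜.vocab, t ∈ 𝒜.rel Q h)

/-- The tuples `a, b₁, …, b_m` form an instantiation of `ρ` with respect to the stage `S`: equal
variables receive equal elements, and every body atom is satisfied. -/
structure IsInstantiation (P : Program) (𝒜 : Struc.{u}) (S : Stage 𝒜.carrier) (ρ : Rule)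
    (a : Fin ρ.head.rel.arity → 𝒜.carrier)
    (b : (r : Fin ρ.body.length) → Fin (ρ.body.get r).rel.arity → 𝒜.carrier) : Prop where
  head_head : ∀ i j, ρ.head.args i = ρ.head.args j → a i = a j
  head_body : ∀ i r j, ρ.head.args i = (ρ.body.get r).args j → a i = b r j
  body_body : ∀ r i s j, (ρ.body.get r).args i = (ρ.body.get s).args j → b r i = b s j
  holds : ∀ r, Holds P 𝒜 S (ρ.body.get r).rel (b r)

/-- One application of the rule `ρ`: the relation of its head symbol is enlarged, all others are
kept. -/
def applyRule (P : Program) (𝒜 : Struc.{u}) (S : Stage 𝒜.carrier) (ρ : Rule) : Stage 𝒜.carrier :=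
  Function.update S ρ.head.rel
    (S ρ.head.rel ∪ {a | ∃ b, IsInstantiation P 𝒜 S ρ a b})

/-- The stage reached from the empty relations by applying the rules of `s` in order. -/
def stageAfter (P : Program) (𝒜 : Struc.{u}) (s : List Rule) : Stage 𝒜.carrier :=
  s.foldl (applyRule P 𝒜) (fun _ => ∅)

/-- A finite computation sequence: a sequence of rules of the program after which no further rule
application adds a tuple. -/
def IsFiniteComputation (P : Program) (𝒜 : Struc.{u}) (s : List Rule) : Prop :=
  (∀ ρ ∈ s, ρ ∈ P) ∧ ∀ ρ ∈ P, applyRule P 𝒜 (stageAfter P 𝒜 s) ρ = stageAfter P 𝒜 s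

/-- An infinite computation sequence: every rule of the program occurs infinitely often. -/
def IsInfiniteComputation (P : Program) (s : ℕ → Rule) : Prop :=
  (∀ i, s i ∈ P) ∧ ∀ ρ ∈ P, {i | s i = ρ}.Infinite

/-- The closure ordinal of `P` on `𝒜`: the length of a shortest computation sequence
(`⊤` if all of them are infinite). -/
noncomputable def Program.cl (P : Program) (𝒜 : Struc.{u}) : ℕ∞ :=
  sInf {l | (∃ s : List Rule, IsFiniteComputation P 𝒜 s ∧ l = s.length) ∨
    ∃ s : ℕ → Rule, IsInfiniteComputation P s ∧ l = ⊤}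

/-- The uniform closure ordinal of `P` on the class `C`: the maximum of the closure ordinals,
`⊤` if they are unbounded. -/
noncomputable def Program.ucl (P : Program) (C : Set Struc.{u}) : ℕ∞ := ⨆ 𝒜 ∈ C, P.cl 𝒜

/-- `P` is uniformly bounded on `C`. -/
def Program.UniformlyBounded (P : Program) (C : Set Struc.{u}) : Prop := P.ucl C < ⊤

/-- The class of all (strict) linear orders, as structures of vocabulary `{<}`. -/
def LO : Set Struc.{u} :=
  {𝒜 | 𝒜.vocab = {ltSym} ∧ ∃ h : ltSym ∈ 𝒜.vocab,
    IsStrictTotalOrder 𝒜.carrier (fun a b => (![a, b] : Fin 2 → 𝒜.carrier) ∈ 𝒜.rel ltSym h)}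

end Datalog

/-! Rule bodies are positive, so strictly monotone maps between linear orders preserve every stage
(`comp_mem_simStage`). A tuple derived in `h` simultaneous rounds is already derived on a suborder
of at most `(P.size + 1) ^ (h + 2)` elements (`exists_finset_mem_simStage`). Hence it suffices to
find a round that adds nothing on finite orders of a size controlled by its number
(`simStage_succ_le_of_fin`).

Suppose every round up to some bound adds a tuple on such a small order. Describe the tuple by a
vector that records its relation symbol, the size of the order, the positions and the gaps. If one
vector lies below a later one, some strictly monotone map takes the first tuple to the second
(`exists_strictMono_of_gapVector_le`), so the second was derivable before its own round, a
contradiction. The vectors thus form a bad sequence in the sense of Dickson's lemma with entries of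
controlled size, and `length_le_dicksonBound` bounds its length computably in `P.size`. Finally, a
pass through all rules simulates a round, so the closure ordinal is at most rounds times rules. -/

namespace Datalog

/-! ### An effective form of Dickson's lemma -/

/-- The fast growing functions that bound the length of controlled bad sequences. -/
def dicksonBound (G : ℕ → ℕ) : ℕ → ℕ → ℕ
  | 0, s => s
  | d + 1, s => dicksonBound G d ((fun x => G (dicksonBound G d x))^[s] s)

theorem le_dicksonBound {G : ℕ → ℕ} (hG : ∀ s, s ≤ G s) (d s : ℕ) : s ≤ dicksonBound G d s := by
  induction d generalizing s with
  | zero => exact le_rfl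
  | succ d ih =>
    refine le_trans ?_ (ih _)
    exact Function.id_le_iterate_of_id_le (fun x => (ih x).trans (hG _)) s s

theorem monotone_dicksonBound {G : ℕ → ℕ} (hG : ∀ s, s ≤ G s) (hmono : Monotone G) (d : ℕ) :
    Monotone (dicksonBound G d) := by
  induction d with
  | zero => exact monotone_id
  | succ d ih =>
    intro s t hst
    have hm : Monotone fun x => G (dicksonBound G d x) := hmono.comp ih
    have hle : id ≤ fun x => G (dicksonBound G d x) :=
      fun x => (le_dicksonBound hG d x).trans (hG _)
    exact ih ((hm.iterate s hst).trans (Function.monotone_iterate_of_id_le hle hst t))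

section Dickson

variable {ι : Type*} [Fintype ι]

/-- The vector `x` agrees with the partial assignment `β`. -/
def InBox (β : ι → Option ℕ) (x : ι → ℕ) : Prop := ∀ i v, β i = some v → x i = v

/-- The number of coordinates left free by a partial assignment. -/
def freeDim (β : ι → Option ℕ) : ℕ := (Finset.univ.filter fun i => β i = none).card

open Classical in
/-- The subboxes of `β` obtained by fixing one more coordinate to a value below `M`. -/
noncomputable def subBoxes (β : ι → Option ℕ) (M : ℕ) : Finset (ι → Option ℕ) :=
  ((Finset.univ.filter fun i => β i = none) ×ˢ Finset.range M).image
    fun p => Function.update β p.1 (some p.2)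

theorem card_subBoxes_le (β : ι → Option ℕ) (M : ℕ) :
    (subBoxes β M).card ≤ Fintype.card ι * M := by
  classical
  refine Finset.card_image_le.trans ?_
  rw [Finset.card_product, Finset.card_range]
  exact Nat.mul_le_mul_right _ (Finset.card_filter_le _ _)

theorem freeDim_lt_of_mem_subBoxes {β γ : ι → Option ℕ} {M : ℕ} (h : γ ∈ subBoxes β M) :
    freeDim γ < freeDim β := by
  classical
  obtain ⟨⟨i, v⟩, hp, rfl⟩ := Finset.mem_image.1 h
  have hi : β i = none := by simpa using (Finset.mem_product.1 hp).1
  refine Finset.card_lt_card ⟨fun j hj => ?_, fun hsub => ?_⟩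
  · by_cases hji : j = i
    · simp [hji] at hj
    · simpa [hji] using hj
  · have := hsub (by simpa using hi : i ∈ Finset.univ.filter fun i => β i = none)
    simp at this

/-- Some coordinate of `y` is smaller than that of `x`, hence below `M`. It is free in `β`, because
both vectors agree with `β` on the fixed coordinates. So in a bad sequence, everything after the
first visit to a box that returns to it lies in finitely many boxes of smaller dimension. -/
theorem exists_mem_subBoxes {β : ι → Option ℕ} {M : ℕ} {x y : ι → ℕ} (hx : InBox β x)
    (hy : InBox β y) (hM : ∀ i, x i ≤ M) (hxy : ¬ x ≤ y) : ∃ γ ∈ subBoxes β M, InBox γ y := by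
  classical
  obtain ⟨i, hi⟩ : ∃ i, y i < x i := by simpa [Pi.le_def] using hxy
  have hβ : β i = none := by
    cases h : β i with
    | none => rfl
    | some v => rw [hx i v h, hy i v h] at hi; exact absurd hi (lt_irrefl _)
  refine ⟨Function.update β i (some (y i)), Finset.mem_image.2 ⟨(i, y i), ?_, rfl⟩, ?_⟩
  · simpa [hβ] using hi.trans_le (hM i)
  · intro j v hj
    by_cases hji : j = i
    · subst hji; simpa using hj
    · exact hy j v (by simpa [hji] using hj)

/-- A bad sequence of vectors whose tail lies in a bounded number of boxes has bounded length. -/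
theorem length_le_of_boxes {G g : ℕ → ℕ} (hG : ∀ s, s ≤ G s) (hmono : Monotone G)
    (hg : Monotone g) {n : ℕ} (hgG : ∀ s, n ≤ s → s + Fintype.card ι * g s + 1 ≤ G s)
    {x : ℕ → ι → ℕ} (hx : ∀ a i, x a i ≤ g a) (d : ℕ) :
    ∀ (N s a : ℕ) (L : Finset (ι → Option ℕ)), n ≤ s → a ≤ s → L.card ≤ s →
      (∀ β ∈ L, freeDim β < d) → (∀ i j, i < j → j < N → ¬ x i ≤ x j) →
      (∀ c, a ≤ c → c < N → ∃ β ∈ L, InBox β (x c)) → N ≤ dicksonBound G d s := by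
  classical
  have hle := le_dicksonBound hG
  have hmon := monotone_dicksonBound hG hmono
  induction d with
  | zero =>
    intro N s a L _ has _ hL _ hcov
    by_contra hlt
    obtain ⟨β, hβ, -⟩ := hcov a le_rfl (has.trans_lt (not_le.1 hlt))
    exact absurd (hL β hβ) (Nat.not_lt_zero _)
  | succ d ih =>
    -- `U` holds the boxes still to be split, `L` those of dimension below `d`; `s` bounds the
    -- starting index and the size of `L`. Splitting one box of `U` costs one application of `fun x
    -- => G (dicksonBound G d x)`.
    have key : ∀ (m N s a : ℕ) (U L : Finset (ι → Option ℕ)), n ≤ s → a ≤ s → U.card ≤ m →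
        L.card ≤ s → (∀ β ∈ U, freeDim β ≤ d) → (∀ β ∈ L, freeDim β < d) →
        (∀ i j, i < j → j < N → ¬ x i ≤ x j) →
        (∀ c, a ≤ c → c < N → ∃ β ∈ U ∪ L, InBox β (x c)) →
        N ≤ dicksonBound G d ((fun x => G (dicksonBound G d x))^[m] s) := by
      intro m
      induction m with
      | zero =>
        intro N s a U L hns has hU hLs _ hL hbad hcov
        have hU0 : U = ∅ := Finset.card_eq_zero.1 (Nat.le_zero.1 hU)
        exact ih N s a L hns has hLs hL hbad (by simpa [hU0] using hcov)
      | succ m ihm =>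
        intro N s a U L hns has hU hLs hUd hL hbad hcov
        by_cases hhit : ∃ c, a ≤ c ∧ c < N ∧ ∃ β ∈ U, InBox β (x c)
        · obtain ⟨hac, hcN, β, hβU, hβ⟩ := Nat.find_spec hhit
          set c := Nat.find hhit with hc
          -- Before the first visit `c` to `U` only boxes of `L` are used, so the induction
          -- hypothesis applies to the sequence cut off at `c`.
          have hcs : c ≤ dicksonBound G d s := by
            refine ih c s a L hns has hLs hL (fun i j hij hj => hbad i j hij (hj.trans hcN)) ?_
            intro e hae hec
            obtain ⟨γ, hγ, hin⟩ := hcov e hae (hec.trans hcN)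
            rcases Finset.mem_union.1 hγ with h | h
            · exact absurd ⟨hae, hec.trans hcN, γ, h, hin⟩ (Nat.find_min hhit hec)
            · exact ⟨γ, h, hin⟩
          have hns' : n ≤ dicksonBound G d s := hns.trans (hle d s)
          have hGb := hgG _ hns'
          -- The visited box is traded for its subboxes; `G` absorbs their number as well as the new
          -- starting index `c + 1`.
          refine ihm N (G (dicksonBound G d s)) (c + 1) (U.erase β) (L ∪ subBoxes β (g c))
            (hns'.trans (hG _)) (by omega) ?_ ?_ ?_ ?_ hbad ?_
          · rw [Finset.card_erase_of_mem hβU]; omega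
          · refine (Finset.card_union_le _ _).trans ?_
            have h1 := card_subBoxes_le β (g c)
            have h2 := Nat.mul_le_mul_left (Fintype.card ι) (hg hcs)
            have h3 := hle d s
            omega
          · exact fun γ hγ => hUd γ (Finset.mem_of_mem_erase hγ)
          · intro γ hγ
            rcases Finset.mem_union.1 hγ with h | h
            · exact hL γ h
            · exact (freeDim_lt_of_mem_subBoxes h).trans_le (hUd β hβU)
          · intro e hce heN
            obtain ⟨γ, hγ, hin⟩ := hcov e (by omega) heN
            by_cases hγβ : γ = β
            · subst hγβ
              obtain ⟨δ, hδ, hinδ⟩ :=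
                exists_mem_subBoxes hβ hin (hx c) (hbad c e (by omega) heN)
              exact ⟨δ, by simp [hδ], hinδ⟩
            · refine ⟨γ, ?_, hin⟩
              rcases Finset.mem_union.1 hγ with h | h <;> simp [h, hγβ]
        · have h1 : N ≤ dicksonBound G d s := by
            refine ih N s a L hns has hLs hL hbad fun c hac hcN => ?_
            obtain ⟨γ, hγ, hin⟩ := hcov c hac hcN
            rcases Finset.mem_union.1 hγ with h | h
            · exact absurd ⟨c, hac, hcN, γ, h, hin⟩ hhit
            · exact ⟨γ, h, hin⟩
          refine h1.trans (hmon d ?_)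
          exact Function.id_le_iterate_of_id_le (fun x => (hle d x).trans (hG _)) (m + 1) s
    intro N s a L hns has hLs hL hbad hcov
    refine key s N s a (L.filter fun β => freeDim β = d) (L.filter fun β => ¬ freeDim β = d) hns has
      ((Finset.card_filter_le _ _).trans hLs) ((Finset.card_filter_le _ _).trans hLs) ?_ ?_ hbad ?_
    · intro β hβ
      exact (Finset.mem_filter.1 hβ).2.le
    · intro β hβ
      have h1 := hL β (Finset.mem_filter.1 hβ).1
      have h2 := (Finset.mem_filter.1 hβ).2
      omega
    · rw [Finset.filter_union_filter_not_eq]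
      exact hcov

/-- **Effective Dickson lemma**: the length of a bad sequence in `ι → ℕ` whose entries are
controlled by `g` is bounded by `dicksonBound`. -/
theorem length_le_dicksonBound {G g : ℕ → ℕ} (hG : ∀ s, s ≤ G s) (hmono : Monotone G)
    (hg : Monotone g) {n : ℕ} (hn : 1 ≤ n)
    (hgG : ∀ s, n ≤ s → s + Fintype.card ι * g s + 1 ≤ G s)
    {x : ℕ → ι → ℕ} (hx : ∀ a i, x a i ≤ g a) {N : ℕ}
    (hbad : ∀ i j, i < j → j < N → ¬ x i ≤ x j) :
    N ≤ dicksonBound G (Fintype.card ι + 1) n := by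
  refine length_le_of_boxes hG hmono hg hgG hx _ N n 0 {fun _ => none} le_rfl (Nat.zero_le _)
    (by simpa using hn) ?_ hbad ?_
  · intro β _
    exact Nat.lt_succ_of_le (Finset.card_filter_le _ _)
  · intro c _ _
    exact ⟨_, Finset.mem_singleton_self _, fun i v h => by simp at h⟩

end Dickson

/-! ### Computability of `dicksonBound`, uniformly in the dimension -/

open Nat.Partrec in
/-- A code for `dicksonBound G d`, computed from a code for `G`. -/
def dicksonCode (cG : Code) : ℕ → Code
  | 0 => Code.id
  | d + 1 =>
    let c := dicksonCode cG d
    -- The recursion step receives `(s, (k, previous value))`, whence `right` twice; `pair id id`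
    -- makes `s` both the initial value and the number of iterations.
    c.comp ((Code.prec Code.id (cG.comp (c.comp (Code.right.comp Code.right)))).comp
      (Code.pair Code.id Code.id))

open Nat.Partrec in
theorem eval_comp_of_eval_eq {cf cg : Code} {m k : ℕ} (h : cg.eval m = Part.some k) :
    (cf.comp cg).eval m = cf.eval k := by
  change Part.bind (cg.eval m) (fun x => cf.eval x) = _
  rw [h, Part.bind_some]

open Nat.Partrec in
theorem eval_dicksonCode {G : ℕ → ℕ} {cG : Code} (hc : ∀ s, cG.eval s = Part.some (G s))
    (d s : ℕ) : (dicksonCode cG d).eval s = Part.some (dicksonBound G d s) := by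
  induction d generalizing s with
  | zero => simp [dicksonCode, dicksonBound]
  | succ d ih =>
    have hrec : ∀ k, (Code.prec Code.id
        (cG.comp ((dicksonCode cG d).comp (Code.right.comp Code.right)))).eval (Nat.pair s k) =
        Part.some ((fun x => G (dicksonBound G d x))^[k] s) := by
      intro k
      induction k with
      | zero => simp [Code.eval_prec_zero]
      | succ k ihk =>
        rw [Code.eval_prec_succ, ihk, Function.iterate_succ_apply']
        refine (Part.bind_some _ _).trans ?_
        rw [eval_comp_of_eval_eq, hc]
        rw [eval_comp_of_eval_eq, ih]
        rw [eval_comp_of_eval_eq (k := Nat.pair k ((fun x => G (dicksonBound G d x))^[k] s))] <;>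
          simp [Code.eval]
    have hpair : (Code.pair Code.id Code.id).eval s = Part.some (Nat.pair s s) := by
      simp [Code.eval, Seq.seq]
    have hcomp := (eval_comp_of_eval_eq hpair).trans (hrec s)
    exact (eval_comp_of_eval_eq hcomp).trans (ih _)

open Nat.Partrec in
-- The dimension in `stageBound` grows with the program, so computability for each fixed `d` is not
-- enough. Codes are therefore produced effectively from `d` and then run by a universal machine.
theorem primrec_dicksonCode (cG : Code) : Primrec (dicksonCode cG) := by
  have hstep : Primrec fun c : Code =>
      c.comp ((Code.prec Code.id (cG.comp (c.comp (Code.right.comp Code.right)))).comp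
        (Code.pair Code.id Code.id)) := by
    apply_rules [Code.primrec₂_prec.comp, Code.primrec₂_comp.comp, Primrec.id, Primrec.const]
  have h : Primrec (Nat.rec Code.id fun _ c =>
      c.comp ((Code.prec Code.id (cG.comp (c.comp (Code.right.comp Code.right)))).comp
        (Code.pair Code.id Code.id)) : ℕ → Code) :=
    Primrec.nat_rec₁ _ (hstep.comp Primrec.snd)
  refine h.of_eq fun n => ?_
  induction n with
  | zero => rfl
  | succ n ih => simp only [dicksonCode]; rw [← ih]

open Nat.Partrec in
theorem computable₂_dicksonBound {G : ℕ → ℕ} (hG : Computable G) :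
    Computable₂ (dicksonBound G) := by
  obtain ⟨cG, hc⟩ := Code.exists_code.1 (Partrec.nat_iff.1 hG)
  have hc' : ∀ s, cG.eval s = Part.some (G s) := fun s => by rw [hc]; rfl
  apply _root_.Partrec.of_eq_tot
    (f := fun p : ℕ × ℕ => (dicksonCode cG p.1).eval p.2)
    (g := fun p : ℕ × ℕ => dicksonBound G p.1 p.2)
  · exact Code.eval_part.comp ((primrec_dicksonCode cG).to_comp.comp Computable.fst) Computable.snd
  · intro p
    simp [eval_dicksonCode hc']

/-! ### Linear orders as structures -/

/-- A linear order as a structure of vocabulary `{<}`. -/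
abbrev loStruc (A : Type u) [LinearOrder A] : Struc.{u} where
  carrier := A
  vocab := {ltSym}
  -- Increasing tuples make sense in every arity, which avoids casts; for `ltSym`, the only symbol
  -- of the vocabulary, they form the relation `<`.
  rel _ _ := {t | ∀ i j, i < j → t i < t j}

theorem exists_eq_loStruc {𝒜 : Struc.{u}} (h𝒜 : 𝒜 ∈ LO.{u}) :
    ∃ (A : Type u) (_ : LinearOrder A), 𝒜 = loStruc A := by
  classical
  obtain ⟨A, vocab, rel⟩ := 𝒜
  obtain ⟨hv, hmem, hlt⟩ := h𝒜
  dsimp only at hv hmem hlt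
  subst hv
  refine ⟨A, linearOrderOfSTO fun a b => (![a, b] : Fin 2 → A) ∈ rel ltSym hmem, ?_⟩
  unfold loStruc
  congr
  funext R hR
  obtain rfl := Finset.mem_singleton.1 hR
  ext t
  have ht : (![t (0 : Fin 2), t (1 : Fin 2)] : Fin 2 → A) = t := by
    funext i
    fin_cases i <;> rfl
  constructor
  · intro h i j hij
    have hj2 : j.1 < 2 := j.2
    have hij' : i.1 < j.1 := hij
    obtain rfl : i = (0 : Fin 2) := Fin.ext (show i.1 = 0 by omega)
    obtain rfl : j = (1 : Fin 2) := Fin.ext (show j.1 = 1 by omega)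
    change (![t (0 : Fin 2), t (1 : Fin 2)] : Fin 2 → A) ∈ rel ltSym hmem
    rw [ht]; exact h
  · intro h
    have h01 : (![t (0 : Fin 2), t (1 : Fin 2)] : Fin 2 → A) ∈ rel ltSym hmem :=
      h (0 : Fin 2) (1 : Fin 2) (by decide)
    rw [ht] at h01; exact h01

/-! ### Simultaneous stages -/

section Stages

variable (P : Program) (𝒜 : Struc.{u})

theorem mem_applyRule {S : Stage 𝒜.carrier} {ρ : Rule} {R : RelSym}
    {t : Fin R.arity → 𝒜.carrier} :
    t ∈ applyRule P 𝒜 S ρ R ↔ t ∈ S R ∨ ∃ (e : ρ.head.rel = R) (b : _),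
      IsInstantiation P 𝒜 S ρ (fun i => t (Fin.cast (congrArg RelSym.arity e) i)) b := by
  by_cases e : ρ.head.rel = R
  · subst e
    simp [applyRule]
  · rw [applyRule, Function.update_of_ne (Ne.symm e)]
    simp [e]

variable {P 𝒜} in
theorem Holds.mono {S S' : Stage 𝒜.carrier} (h : S ≤ S') {Q : RelSym}
    {t : Fin Q.arity → 𝒜.carrier} (ht : Holds P 𝒜 S Q t) : Holds P 𝒜 S' Q t :=
  ht.imp (And.imp_right fun h' => h Q h') id

theorem le_applyRule (S : Stage 𝒜.carrier) (ρ : Rule) : S ≤ applyRule P 𝒜 S ρ :=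
  fun _ _ ht => (mem_applyRule P 𝒜).2 (.inl ht)

theorem applyRule_mono {S S' : Stage 𝒜.carrier} (h : S ≤ S') (ρ : Rule) :
    applyRule P 𝒜 S ρ ≤ applyRule P 𝒜 S' ρ := by
  intro R t ht
  rw [mem_applyRule] at ht
  refine (mem_applyRule P 𝒜).2 (ht.imp (fun h' => h R h') ?_)
  rintro ⟨e, b, hb⟩
  exact ⟨e, b, hb.1, hb.2, hb.3, fun r => (hb.4 r).mono h⟩

/-- Simultaneous application of all rules. -/
def applyAll (S : Stage 𝒜.carrier) : Stage 𝒜.carrier :=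
  fun R => S R ∪ {t | ∃ ρ ∈ P, t ∈ applyRule P 𝒜 S ρ R}

/-- The stage reached after `h` simultaneous applications of all rules. -/
def simStage (h : ℕ) : Stage 𝒜.carrier := (applyAll P 𝒜)^[h] fun _ => ∅

theorem simStage_succ (h : ℕ) : simStage P 𝒜 (h + 1) = applyAll P 𝒜 (simStage P 𝒜 h) :=
  Function.iterate_succ_apply' _ _ _

variable {P} in
theorem applyRule_le_applyAll (S : Stage 𝒜.carrier) {ρ : Rule} (hρ : ρ ∈ P) :
    applyRule P 𝒜 S ρ ≤ applyAll P 𝒜 S :=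
  fun _ _ ht => .inr ⟨ρ, hρ, ht⟩

theorem simStage_monotone : Monotone (simStage P 𝒜) :=
  monotone_nat_of_le_succ fun h => by
    rw [simStage_succ]
    exact fun _ _ ht => .inl ht

variable {P 𝒜} in
theorem simStage_le_of_succ_le {h : ℕ} (hh : simStage P 𝒜 (h + 1) ≤ simStage P 𝒜 h) (k : ℕ) :
    simStage P 𝒜 k ≤ simStage P 𝒜 h := by
  rcases le_total k h with hk | hk
  · exact simStage_monotone P 𝒜 hk
  · induction k, hk using Nat.le_induction with
    | base => exact le_rfl
    | succ k hk ih =>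
      rwa [simStage_succ, le_antisymm ih (simStage_monotone P 𝒜 hk), ← simStage_succ]

variable {P} in
theorem stageAfter_le_simStage {s : List Rule} (hs : ∀ ρ ∈ s, ρ ∈ P) :
    stageAfter P 𝒜 s ≤ simStage P 𝒜 s.length := by
  induction s using List.reverseRecOn with
  | nil => exact le_rfl
  | append_singleton s ρ ih =>
    rw [stageAfter, List.foldl_append, List.length_append, List.length_singleton, simStage_succ]
    exact (applyRule_mono P 𝒜 (ih fun σ hσ => hs σ (by simp [hσ])) ρ).trans
      (applyRule_le_applyAll 𝒜 _ (hs ρ (by simp)))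

theorem le_foldl_applyRule (s : List Rule) (S : Stage 𝒜.carrier) :
    S ≤ s.foldl (applyRule P 𝒜) S := by
  induction s generalizing S with
  | nil => exact le_rfl
  | cons ρ s ih => exact (le_applyRule P 𝒜 S ρ).trans (ih _)

theorem applyRule_le_foldl {s : List Rule} {ρ : Rule} (hρ : ρ ∈ s) (S : Stage 𝒜.carrier) :
    applyRule P 𝒜 S ρ ≤ s.foldl (applyRule P 𝒜) S := by
  induction s generalizing S with
  | nil => simp at hρ
  | cons σ s ih =>
    rcases List.mem_cons.1 hρ with rfl | h
    · exact le_foldl_applyRule P 𝒜 s _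
    · exact (applyRule_mono P 𝒜 (le_applyRule P 𝒜 S σ) ρ).trans (ih h _)

/-- Stages only grow during a pass through the rules, so each rule produces at least what it would
produce in a simultaneous round. -/
theorem simStage_le_stageAfter (h : ℕ) :
    simStage P 𝒜 h ≤ stageAfter P 𝒜 (List.replicate h P.toList).flatten := by
  induction h with
  | zero => exact fun _ _ ht => ht.elim
  | succ h ih =>
    rw [List.replicate_succ', List.flatten_append, stageAfter, List.foldl_append, simStage_succ]
    rintro R t (ht | ⟨ρ, hρ, ht⟩)
    · exact le_foldl_applyRule P 𝒜 _ _ R (ih R ht)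
    · have := applyRule_le_foldl P 𝒜 (Finset.mem_toList.2 hρ) _ R (applyRule_mono P 𝒜 ih ρ R ht)
      simpa [stageAfter] using this

variable {P 𝒜} in
/-- If the simultaneous stages are stationary from `h` on, then the closure ordinal is at most `h`
times the number of rules. -/
theorem cl_le_of_simStage_succ_le {h : ℕ} (hh : simStage P 𝒜 (h + 1) ≤ simStage P 𝒜 h) :
    P.cl 𝒜 ≤ ((h * P.card : ℕ) : ℕ∞) := by
  set s := (List.replicate h P.toList).flatten with hs
  have hmem : ∀ ρ ∈ s, ρ ∈ P := by
    intro ρ hρ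
    simp only [hs, List.mem_flatten, List.mem_replicate] at hρ
    obtain ⟨l, ⟨-, rfl⟩, hl⟩ := hρ
    exact Finset.mem_toList.1 hl
  have hstage : stageAfter P 𝒜 s = simStage P 𝒜 h :=
    le_antisymm ((stageAfter_le_simStage 𝒜 hmem).trans (simStage_le_of_succ_le hh _))
      (simStage_le_stageAfter P 𝒜 h)
  refine sInf_le (.inl ⟨s, ⟨hmem, fun ρ hρ => ?_⟩, ?_⟩)
  · refine le_antisymm ?_ (le_applyRule P 𝒜 _ ρ)
    rw [hstage]
    refine (applyRule_le_applyAll 𝒜 _ hρ).trans ?_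
    rwa [← simStage_succ]
  · simp [hs]

end Stages

/-! ### Preservation and small witnesses -/

theorem comp_mem_simStage {A : Type*} {B : Type*} [LinearOrder A] [LinearOrder B] (P : Program)
    {f : A → B} (hf : StrictMono f) (h : ℕ) {R : RelSym} {t : Fin R.arity → A}
    (ht : t ∈ simStage P (loStruc A) h R) : f ∘ t ∈ simStage P (loStruc B) h R := by
  induction h generalizing R with
  | zero => exact ht.elim
  | succ h ih =>
    rw [simStage_succ] at ht ⊢
    rcases ht with ht | ⟨ρ, hρ, ht⟩
    · exact .inl (ih ht)
    · refine .inr ⟨ρ, hρ, ?_⟩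
      refine (mem_applyRule P _).2 (((mem_applyRule P _).1 ht).imp (fun h' => ih h') ?_)
      rintro ⟨e, b, hb⟩
      refine ⟨e, fun r => f ∘ b r, fun i j hij => congrArg f (hb.1 i j hij),
        fun i r j hij => congrArg f (hb.2 i r j hij),
        fun r i s j hij => congrArg f (hb.3 r i s j hij), fun r => ?_⟩
      rcases hb.4 r with ⟨h1, h2⟩ | ⟨h1, h2, h3⟩
      · exact .inl ⟨h1, ih h2⟩
      · exact .inr ⟨h1, h2, fun i j hij => hf (h3 i j hij)⟩

theorem Rule.size_le_size {P : Program} {ρ : Rule} (hρ : ρ ∈ P) : ρ.size ≤ P.size :=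
  Finset.single_le_sum (f := Rule.size) (fun _ _ => Nat.zero_le _) hρ

theorem Rule.head_arity_le_size (ρ : Rule) : ρ.head.rel.arity ≤ ρ.size := by
  unfold Rule.size Atom.size; omega

theorem Rule.body_arity_le_size (ρ : Rule) {α : Atom} (hα : α ∈ ρ.body) :
    α.rel.arity ≤ ρ.size := by
  have := List.single_le_sum (l := ρ.body.map Atom.size) (by simp) α.size
    (List.mem_map_of_mem hα)
  unfold Rule.size
  unfold Atom.size at this ⊢
  omega

theorem Rule.length_body_le_size (ρ : Rule) : ρ.body.length ≤ ρ.size := by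
  have := List.length_le_sum_of_one_le (ρ.body.map Atom.size)
    (by simp only [List.mem_map]; rintro _ ⟨α, -, rfl⟩; unfold Atom.size; omega)
  rw [List.length_map] at this
  unfold Rule.size
  omega

theorem Program.card_le_size (P : Program) : P.card ≤ P.size := by
  rw [Finset.card_eq_sum_ones]
  exact Finset.sum_le_sum fun ρ _ => by unfold Rule.size Atom.size; omega

/-- A tuple of a simultaneous stage already belongs to this stage on a finite suborder of
bounded size. -/
theorem exists_finset_mem_simStage {A : Type u} [LinearOrder A] (P : Program) (h : ℕ)
    {R : RelSym} {t : Fin R.arity → A} (ht : t ∈ simStage P (loStruc A) h R) :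
    ∃ F : Finset A, F.card ≤ (P.size + 1) ^ (h + 2) ∧
      ∃ t' : Fin R.arity → F, (fun i => (t' i : A)) = t ∧ t' ∈ simStage P (loStruc F) h R := by
  classical
  induction h generalizing R with
  | zero => exact ht.elim
  | succ h ih =>
    have hpow : (P.size + 1) ^ (h + 2) ≤ (P.size + 1) ^ (h + 1 + 2) :=
      Nat.pow_le_pow_right (Nat.succ_pos _) (by omega)
    have hold : t ∈ simStage P (loStruc A) h R → ∃ F : Finset A,
        F.card ≤ (P.size + 1) ^ (h + 1 + 2) ∧ ∃ t' : Fin R.arity → F,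
          (fun i => (t' i : A)) = t ∧ t' ∈ simStage P (loStruc F) (h + 1) R := by
      intro h'
      obtain ⟨F, hF, t', ht', hmem⟩ := ih h'
      exact ⟨F, hF.trans hpow, t', ht', simStage_monotone P _ (Nat.le_succ h) R hmem⟩
    rw [simStage_succ] at ht
    rcases ht with ht | ⟨ρ, hρ, ht⟩
    · exact hold ht
    rcases (mem_applyRule P _).1 ht with ht | ⟨rfl, b, hb⟩
    · exact hold ht
    change Fin ρ.head.rel.arity → A at t
    change (r : Fin ρ.body.length) → Fin (ρ.body.get r).rel.arity → A at b
    have hn : ρ.size ≤ P.size := Rule.size_le_size hρ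
    have hr : ∀ r : Fin ρ.body.length, ∃ F : Finset A, F.card ≤ (P.size + 1) ^ (h + 2) ∧
        ∃ b' : Fin (ρ.body.get r).rel.arity → F, (fun i => (b' i : A)) = b r ∧
          Holds P (loStruc F) (simStage P (loStruc F) h) (ρ.body.get r).rel b' := by
      intro r
      rcases hb.4 r with ⟨h1, h2⟩ | ⟨h1, h2, h3⟩
      · obtain ⟨F, hF, b', hb', hmem⟩ := ih h2
        exact ⟨F, hF, b', hb', .inl ⟨h1, hmem⟩⟩
      · refine ⟨Finset.univ.image (b r), ?_,
          fun i => ⟨b r i, Finset.mem_image_of_mem _ (Finset.mem_univ i)⟩, rfl,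
          .inr ⟨h1, h2, fun i j hij => h3 i j hij⟩⟩
        refine Finset.card_image_le.trans ?_
        rw [Finset.card_univ, Fintype.card_fin]
        exact ((ρ.body_arity_le_size (List.get_mem _ _)).trans hn).trans
          ((Nat.le_succ _).trans (Nat.le_self_pow (by omega) _))
    choose F hF b' hb' hH using hr
    -- Head variables need not occur in the body, so the entries of the head tuple are added
    -- separately.
    let E : Finset A := Finset.univ.image t ∪ Finset.univ.biUnion F
    have hsub : ∀ r, F r ⊆ E := fun r =>
      (Finset.subset_biUnion_of_mem F (Finset.mem_univ r)).trans Finset.subset_union_right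
    have htE : ∀ i, t i ∈ E := fun i =>
      Finset.mem_union_left _ (Finset.mem_image_of_mem _ (Finset.mem_univ i))
    refine ⟨E, ?_, fun i => ⟨t i, htE i⟩, rfl, ?_⟩
    · have h1 : (Finset.univ.image t).card ≤ P.size := by
        refine Finset.card_image_le.trans ?_
        rw [Finset.card_univ, Fintype.card_fin]
        exact ρ.head_arity_le_size.trans hn
      have h2 : (Finset.univ.biUnion F).card ≤ P.size * (P.size + 1) ^ (h + 2) := by
        refine (Finset.card_biUnion_le_card_mul _ _ _ fun r _ => hF r).trans ?_
        rw [Finset.card_univ, Fintype.card_fin]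
        exact Nat.mul_le_mul_right _ (ρ.length_body_le_size.trans hn)
      have h3 : P.size + 1 ≤ (P.size + 1) ^ (h + 2) := Nat.le_self_pow (by omega) _
      calc E.card ≤ P.size + P.size * (P.size + 1) ^ (h + 2) :=
            (Finset.card_union_le _ _).trans (Nat.add_le_add h1 h2)
        _ ≤ (P.size + 1) ^ (h + 2) * (P.size + 1) := by rw [mul_add, mul_one, mul_comm]; omega
        _ = _ := (pow_succ _ _).symm
    · rw [simStage_succ]
      refine .inr ⟨ρ, hρ, (mem_applyRule P _).2 (.inr ⟨rfl,
        fun r i => ⟨b' r i, hsub r (b' r i).2⟩, ?_, ?_, ?_, ?_⟩)⟩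
      · exact fun i j hij => Subtype.ext (hb.1 i j hij)
      · exact fun i r j hij => Subtype.ext ((hb.2 i r j hij).trans (congrFun (hb' r) j).symm)
      · intro r i s j hij
        exact Subtype.ext (((congrFun (hb' r) i).trans (hb.3 r i s j hij)).trans
          (congrFun (hb' s) j).symm)
      · intro r
        rcases hH r with ⟨h1, h2⟩ | ⟨h1, h2, h3⟩
        · exact .inl ⟨h1, comp_mem_simStage P (f := fun y : F r => (⟨y, hsub r y.2⟩ : E))
            (fun _ _ hxy => hxy) h h2⟩
        · exact .inr ⟨h1, h2, fun i j hij => h3 i j hij⟩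

/-- A tuple of a simultaneous stage comes from a tuple of this stage on a finite linear order of
bounded size. -/
theorem exists_fin_mem_simStage {A : Type u} [LinearOrder A] (P : Program) (h : ℕ)
    {R : RelSym} {t : Fin R.arity → A} (ht : t ∈ simStage P (loStruc A) h R) :
    ∃ m ≤ (P.size + 1) ^ (h + 2), ∃ f : Fin m → A, StrictMono f ∧
      ∃ t' : Fin R.arity → Fin m, f ∘ t' = t ∧ t' ∈ simStage P (loStruc (Fin m)) h R := by
  obtain ⟨F, hF, t', ht', hmem⟩ := exists_finset_mem_simStage P h ht
  let e := F.orderIsoOfFin rfl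
  refine ⟨F.card, hF, fun i => (e i : A), fun i j hij => e.strictMono hij, e.symm ∘ t', ?_,
    comp_mem_simStage P e.symm.strictMono h hmem⟩
  rw [← ht']
  funext i
  simp

/-- If no tuple is added in stage `h + 1` on small finite orders, then none is added on any
linear order. -/
theorem simStage_succ_le_of_fin {P : Program} {h : ℕ}
    (hfin : ∀ m ≤ (P.size + 1) ^ (h + 3), ∀ (R : RelSym) (t : Fin R.arity → Fin m),
      t ∈ simStage P (loStruc (Fin m)) (h + 1) R → t ∈ simStage P (loStruc (Fin m)) h R)
    (A : Type u) [LinearOrder A] :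
    simStage P (loStruc A) (h + 1) ≤ simStage P (loStruc A) h := by
  intro R t ht
  obtain ⟨m, hm, f, hf, t', rfl, ht'⟩ := exists_fin_mem_simStage P (h + 1) ht
  exact comp_mem_simStage P hf h (hfin m hm R t' ht')

theorem head_mem_of_mem_simStage {P : Program} {𝒜 : Struc.{u}} {h : ℕ} {R : RelSym}
    {t : Fin R.arity → 𝒜.carrier} (ht : t ∈ simStage P 𝒜 h R) : ∃ ρ ∈ P, ρ.head.rel = R := by
  induction h with
  | zero => exact ht.elim
  | succ h ih =>
    rw [simStage_succ] at ht
    rcases ht with ht | ⟨ρ, hρ, ht⟩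
    · exact ih ht
    · rcases (mem_applyRule P _).1 ht with ht | ⟨e, -⟩
      · exact ih ht
      · exact ⟨ρ, hρ, e⟩

/-! ### Encoding tuples of finite linear orders by vectors -/

/-- A tuple of a finite linear order can be mapped to another one by a strictly monotone map if
all distances are large enough. -/
theorem exists_strictMono_of_dist_le {r m m' : ℕ} {t : Fin r → Fin m} {t' : Fin r → Fin m'}
    (hm : m ≤ m') (hlow : ∀ i, (t i : ℕ) ≤ t' i) (hhigh : ∀ i, m - (t i : ℕ) ≤ m' - t' i)
    (hdist : ∀ i j, (t j : ℕ) - t i ≤ (t' j : ℕ) - t' i)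
    (heq : ∀ i j, (t i : ℕ) = t j → (t' i : ℕ) = t' j) :
    ∃ f : Fin m → Fin m', StrictMono f ∧ f ∘ t = t' := by
  -- `φ` is the slowest map that stays above the identity, reaches `t' i` at `t i`, and from there
  -- on advances by at least one per step.
  let φ : ℕ → ℕ := fun x =>
    max x ((Finset.univ.filter fun i => (t i : ℕ) ≤ x).sup fun i => (t' i : ℕ) + (x - t i))
  have hφ : ∀ x y, φ x ≤ y ↔ x ≤ y ∧ ∀ i, (t i : ℕ) ≤ x → (t' i : ℕ) + (x - t i) ≤ y := by
    intro x y
    simp [φ, Finset.sup_le_iff]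
  have hφm : ∀ x, x < m → φ x < m' := by
    intro x hx
    suffices φ x ≤ m' - 1 by omega
    refine (hφ x _).2 ⟨by omega, fun i hi => ?_⟩
    have h1 := hhigh i
    have h2 := (t' i).2
    omega
  have hmono : ∀ x y, x < y → φ x < φ y := by
    intro x y hxy
    have hy := (hφ y _).1 le_rfl
    suffices φ x ≤ φ y - 1 by omega
    refine (hφ x _).2 ⟨by omega, fun i hi => ?_⟩
    have := hy.2 i (by omega)
    omega
  refine ⟨fun x => ⟨φ x, hφm x x.2⟩, fun x y hxy => hmono x y hxy, ?_⟩
  funext j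
  refine Fin.ext (le_antisymm ((hφ _ _).2 ⟨hlow j, fun i hi => ?_⟩) ?_)
  · have h1 := hdist i j
    -- For coinciding positions the truncated difference in `hdist` is `0` and carries no
    -- information; this is where `heq` is needed.
    rcases hi.eq_or_lt with h2 | h2
    · have := heq i j h2
      omega
    · omega
  · have := ((hφ (t j) _).1 le_rfl).2 j le_rfl
    change _ ≤ φ (t j)
    omega

/-- The coordinates of the vector that describes a tuple of length at most `n` in a finite linear
order. -/
abbrev GapIndex (n : ℕ) := Fin 3 ⊕ (Fin n × Bool) ⊕ (Fin n × Fin n × Bool)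

theorem card_gapIndex (n : ℕ) : Fintype.card (GapIndex n) = 3 + (n * 2 + n * (n * 2)) := by
  simp

/-- The vector that describes a list `p` of positions in a linear order with `m` elements, labelled
by a number `c ≤ n`. -/
def gapVector (n m c : ℕ) (p : ℕ → ℕ) : GapIndex n → ℕ
  | .inl i => if i = 0 then m else if i = 1 then c else n - c
  | .inr (.inl (i, b)) => if b then p i else m - p i
  | .inr (.inr (i, j, b)) => if b then (if p i = p j then 1 else 0) else p j - p i

theorem gapVector_le {n m c M : ℕ} {p : ℕ → ℕ} (hm : m ≤ M) (hn : n ≤ M) (hM : 1 ≤ M)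
    (hc : c ≤ n) (hp : ∀ i, p i ≤ m) (i : GapIndex n) : gapVector n m c p i ≤ M := by
  rcases i with i | ⟨i, b⟩ | ⟨i, j, b⟩
  · simp only [gapVector]; split_ifs <;> omega
  · have := hp i
    simp only [gapVector]; split_ifs <;> omega
  · have := hp i
    have := hp j
    simp only [gapVector]; split_ifs <;> omega

/-- The positions of a tuple, padded by `0`. -/
def positions {r m : ℕ} (t : Fin r → Fin m) (i : ℕ) : ℕ := if h : i < r then t ⟨i, h⟩ else 0

theorem positions_le {r m : ℕ} (t : Fin r → Fin m) (i : ℕ) : positions t i ≤ m := by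
  unfold positions
  split_ifs with h
  · exact (t _).2.le
  · exact Nat.zero_le _

@[simp]
theorem positions_coe {r m : ℕ} (t : Fin r → Fin m) (i : Fin r) : positions t i = t i := by
  simp [positions]

/-- The label enters both as `c` and as `n - c`, so comparing vectors forces equality of labels. The
same device, distance from below and from above, handles the positions. -/
theorem eq_of_gapVector_le {n m m' c c' : ℕ} {p p' : ℕ → ℕ} (hc : c ≤ n) (hc' : c' ≤ n)
    (h : gapVector n m c p ≤ gapVector n m' c' p') : c = c' := by
  have h1 : c ≤ c' := by simpa [gapVector] using h (.inl 1)
  have h2 : n - c ≤ n - c' := by simpa [gapVector] using h (.inl 2)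
  omega

theorem exists_strictMono_of_gapVector_le {n m m' c c' r : ℕ} (hr : r ≤ n) {t : Fin r → Fin m}
    {t' : Fin r → Fin m'}
    (h : gapVector n m c (positions t) ≤ gapVector n m' c' (positions t')) :
    ∃ f : Fin m → Fin m', StrictMono f ∧ f ∘ t = t' := by
  let e : Fin r → Fin n := Fin.castLE hr
  apply exists_strictMono_of_dist_le
  · simpa [gapVector] using h (.inl 0)
  · intro i
    simpa [gapVector, e] using h (.inr (.inl (e i, true)))
  · intro i
    simpa only [gapVector, e, Fin.val_castLE, positions_coe, Bool.false_eq_true, if_false]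
      using h (.inr (.inl (e i, false)))
  · intro i j
    simpa only [gapVector, e, Fin.val_castLE, positions_coe, Bool.false_eq_true, if_false]
      using h (.inr (.inr (e i, e j, false)))
  · intro i j hij
    have := h (.inr (.inr (e i, e j, true)))
    simp only [gapVector, e, Fin.val_castLE, positions_coe, if_true, hij] at this
    by_contra hne
    simp [hne] at this

/-! ### The bound -/

/-- The growth function that controls the sizes of witnesses. -/
def growth (s : ℕ) : ℕ := s + (3 + (s * 2 + s * (s * 2))) * (s + 1) ^ (s + 3) + 1

theorem monotone_growth : Monotone growth := by
  intro s t h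
  have : (s + 1) ^ (s + 3) ≤ (t + 1) ^ (t + 3) :=
    (Nat.pow_le_pow_left (by omega) _).trans (Nat.pow_le_pow_right (Nat.succ_pos _) (by omega))
  unfold growth
  gcongr

/-- A bound for the number of simultaneous stages of a program of length `n`. -/
def stageBound (n : ℕ) : ℕ := dicksonBound growth (3 + (n * 2 + n * (n * 2)) + 1) (n + 1)

theorem primrec_growth : Primrec growth := by
  have hpow : Primrec₂ ((· ^ ·) : ℕ → ℕ → ℕ) :=
    Primrec₂.unpaired'.1 Nat.Primrec.pow
  have hid : Primrec (fun s : ℕ => s) := Primrec.id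
  have hsucc : Primrec (fun s : ℕ => s + 1) := Primrec.succ
  have hdouble : Primrec (fun s : ℕ => s * 2) := Primrec.nat_mul.comp hid (Primrec.const 2)
  exact Primrec.succ.comp (Primrec.nat_add.comp hid (Primrec.nat_mul.comp
    (Primrec.nat_add.comp (Primrec.const 3) (Primrec.nat_add.comp hdouble
      (Primrec.nat_mul.comp hid hdouble)))
    (hpow.comp hsucc (Primrec.nat_add.comp hid (Primrec.const 3)))))

theorem computable_stageBound : Computable stageBound := by
  have hid : Primrec (fun s : ℕ => s) := Primrec.id
  have hdouble : Primrec (fun s : ℕ => s * 2) := Primrec.nat_mul.comp hid (Primrec.const 2)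
  have hdim : Primrec (fun n : ℕ => 3 + (n * 2 + n * (n * 2)) + 1) :=
    Primrec.succ.comp (Primrec.nat_add.comp (Primrec.const 3) (Primrec.nat_add.comp hdouble
      (Primrec.nat_mul.comp hid hdouble)))
  exact (computable₂_dicksonBound primrec_growth.to_comp).comp hdim.to_comp Computable.succ

/-- Some stage below the bound adds no tuple on small finite linear orders. -/
theorem exists_stationary_stage (P : Program) :
    ∃ h ≤ stageBound P.size, ∀ m ≤ (P.size + 1) ^ (h + 3),
      ∀ (R : RelSym) (t : Fin R.arity → Fin m), t ∈ simStage P (loStruc (Fin m)) (h + 1) R →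
        t ∈ simStage P (loStruc (Fin m)) h R := by
  classical
  by_contra! hne
  set n := P.size with hn
  let I : Finset RelSym := P.image fun ρ => ρ.head.rel
  have hI : I.card ≤ n := Finset.card_image_le.trans P.card_le_size
  let code : RelSym → ℕ := fun R => if hR : R ∈ I then I.equivFin ⟨R, hR⟩ else 0
  have hcode : ∀ R, code R ≤ n := by
    intro R
    simp only [code]
    split_ifs with hR
    · exact (I.equivFin ⟨R, hR⟩).2.le.trans hI
    · exact Nat.zero_le _
  have hinj : ∀ R ∈ I, ∀ R' ∈ I, code R = code R' → R = R' := by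
    intro R hR R' hR' h
    simp only [code, hR, hR', dif_pos] at h
    simpa using I.equivFin.injective (Fin.ext h)
  have hwit : ∀ h, ∃ (m : ℕ) (R : RelSym) (t : Fin R.arity → Fin m), m ≤ (n + 1) ^ (h + 3) ∧
      (h ≤ stageBound n → t ∈ simStage P (loStruc (Fin m)) (h + 1) R ∧
        t ∉ simStage P (loStruc (Fin m)) h R) := by
    intro h
    by_cases hh : h ≤ stageBound n
    · obtain ⟨m, hm, R, t, h1, h2⟩ := hne h hh
      exact ⟨m, R, t, hm, fun _ => ⟨h1, h2⟩⟩
    -- A dummy witness beyond the bound makes the sequence total; it still obeys the size control.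
    · exact ⟨0, ⟨0, 0⟩, fun i => i.elim0, Nat.zero_le _, fun h' => absurd h' hh⟩
  choose m R t hm ht using hwit
  have hRI : ∀ h ≤ stageBound n, R h ∈ I ∧ (R h).arity ≤ n := by
    intro h hh
    obtain ⟨ρ, hρ, e⟩ := head_mem_of_mem_simStage (ht h hh).1
    refine ⟨Finset.mem_image.2 ⟨ρ, hρ, e⟩, ?_⟩
    rw [← e]
    exact ρ.head_arity_le_size.trans (Rule.size_le_size hρ)
  -- The rounds from `0` to `stageBound n` give `stageBound n + 1` vectors, one more than a bad
  -- sequence may have.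
  have hlen := length_le_dicksonBound (ι := GapIndex n) (G := growth)
    (g := fun h => (n + 1) ^ (h + 3)) (n := n + 1) (N := stageBound n + 1)
    (x := fun h => gapVector n (m h) (code (R h)) (positions (t h)))
    (fun s => by unfold growth; omega) monotone_growth
    (fun a b hab => Nat.pow_le_pow_right (Nat.succ_pos _) (by omega)) (by omega) ?_ ?_ ?_
  · rw [card_gapIndex] at hlen
    exact absurd hlen (by unfold stageBound; omega)
  -- `growth` does not mention `n`: once `s` exceeds `n`, it dominates the number of coordinates
  -- times the witness size.
  · intro s hs
    rw [card_gapIndex]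
    unfold growth
    gcongr <;> omega
  · intro h i
    have h1 : n + 1 ≤ (n + 1) ^ (h + 3) := Nat.le_self_pow (by omega) _
    exact gapVector_le (hm h) (by omega) (by omega) (hcode _) (positions_le _) i
  · intro i j hij hj hle
    have hi' : i ≤ stageBound n := by omega
    have hj' : j ≤ stageBound n := by omega
    have hR : R i = R j := hinj _ (hRI i hi').1 _ (hRI j hj').1
      (eq_of_gapVector_le (hcode _) (hcode _) hle)
    have hti := (ht i hi').1
    have htj := (ht j hj').2
    have har := (hRI i hi').2
    generalize t i = ti at *
    generalize t j = tj at *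
    generalize R i = Ri at *
    generalize R j = Rj at *
    subst hR
    obtain ⟨f, hf, rfl⟩ := exists_strictMono_of_gapVector_le har hle
    exact htj (comp_mem_simStage P hf j (simStage_monotone P _ (by omega : i + 1 ≤ j) _ hti))

theorem ucl_LO_le (P : Program) : P.ucl LO.{u} ≤ ((stageBound P.size * P.size : ℕ) : ℕ∞) := by
  refine iSup₂_le fun 𝒜 h𝒜 => ?_
  obtain ⟨A, _, rfl⟩ := exists_eq_loStruc h𝒜
  obtain ⟨h, hh, hfin⟩ := exists_stationary_stage P
  refine (cl_le_of_simStage_succ_le (simStage_succ_le_of_fin hfin A)).trans ?_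
  exact_mod_cast Nat.mul_le_mul hh P.card_le_size

end Datalog

theorem mainTheorem2 :
    (∀ P : Datalog.Program, P.IsOverClass Datalog.LO.{u} → P.UniformlyBounded Datalog.LO.{u}) ∧
    ∃ b : ℕ → ℕ, Computable b ∧
      ∀ P : Datalog.Program, P.IsOverClass Datalog.LO.{u} →
        P.ucl Datalog.LO.{u} ≤ (b P.size : ℕ∞) := by
  refine ⟨fun P _ => (Datalog.ucl_LO_le P).trans_lt (ENat.natCast_lt_top _),
    fun n => Datalog.stageBound n * n, ?_, fun P _ => Datalog.ucl_LO_le P⟩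
  exact Primrec.nat_mul.to_comp.comp Datalog.computable_stageBound Computable.id
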